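/- For a permutation $\pi=\pi_1\cdots\pi_n$ of $\{1,\dots,n\}$ let $\mathrm{des}(\pi)=|\{i\in\{1,\dots,n-1\}:\pi_i>\pi_{i+1}\}|$, $\mathrm{exc}(\pi)=|\{i:\pi_i>i\}|$ and $\mathrm{maj}(\pi)=\sum_{i:\,\pi_i>\pi_{i+1}} i$. Write $S_n$ for the set of these permutations. For $n\ge 1$ let $$A_n(t)=\sum_{\pi\in S_n}t^{\mathrm{des}(\pi)},\qquad A_n(t,q)=\sum_{\pi\in S_n}t^{\mathrm{exc}(\pi)}q^{\mathrm{maj}(\pi)-\mathrm{exc}(\pi)},$$ with the convention $A_0(t)=0$. Let the $q$-binomial-Eulerian polynomials be $$\tilde A_n(t,q)=1+t\sum_{m=1}^n\binom{n}{m}_q A_m(t,q),\qquad \binom{n}{m}_q=\frac{(q;q)_n}{(q;q)_m\,(q;q)_{n-m}},\quad (q;q)_n=\prod_{i=1}^n(1-q^i),$$ where $\binom{n}{m}_q$ is regarded as a polynomial in $q$. Then, as polynomials in $t$, for every integer $m\ge 1$ $$\tilde A_{2m}(t,-1)=1+t\sum_{k=1}^m\binom{m}{k}(1+t)^kA_k(t),$$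 and for every integer $m\ge 0$ $$\tilde A_{2m+1}(t,-1)=1+t\sum_{k=0}^m\binom{m}{k}(1+t)^k\bigl(A_k(t)+A_{k+1}(t)\bigr).$$ -/

import Mathlib

open Polynomial

namespace QBinomialEulerian

/-! ### Permutation statistics

Permutations of `{1, …, n}` are modelled by `Equiv.Perm (Fin n)`; the position `i : Fin n`
stands for the position `i + 1`. -/

/-- The (0-based) descent positions of `π`: those `i` with `i + 1 < n` and `π (i + 1) < π i`. -/
def descents {n : ℕ} (π : Equiv.Perm (Fin n)) : Finset (Fin n) :=
  Finset.univ.filter fun i => ∃ h : (i : ℕ) + 1 < n, π ⟨(i : ℕ) + 1, h⟩ < π i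

/-- The number of descents of `π`. -/
def des {n : ℕ} (π : Equiv.Perm (Fin n)) : ℕ := (descents π).card

/-- The number of excedances of `π` (the last position is never an excedance). -/
def exc {n : ℕ} (π : Equiv.Perm (Fin n)) : ℕ :=
  (Finset.univ.filter fun i : Fin n => i < π i).card

/-- The major index of `π`: the sum of its 1-based descent positions. -/
def maj {n : ℕ} (π : Equiv.Perm (Fin n)) : ℕ := ∑ i ∈ descents π, ((i : ℕ) + 1)

/-- At or after every excedance there is a descent. -/
theorem exists_descent_of_lt {n : ℕ} (π : Equiv.Perm (Fin n)) (i : Fin n) (hi : i < π i) :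
    ∃ j ∈ descents π, i ≤ j := by
  by_contra! hno
  have key : ∀ k : ℕ, ∀ h : (i : ℕ) + k < n, (π i : ℕ) + k ≤ π ⟨(i : ℕ) + k, h⟩ := by
    intro k
    induction k with
    | zero => intro h; simp
    | succ k ih =>
      intro h
      have h1 := ih (by omega)
      have h2 : (⟨(i : ℕ) + k, by omega⟩ : Fin n) ∉ descents π := by
        intro hm
        have h3 := hno _ hm
        rw [Fin.lt_def] at h3
        simp at h3
      simp only [descents, Finset.mem_filter, Finset.mem_univ, true_and, not_exists, not_lt] at h2
      have h4 := h2 (by omega)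
      have h5 : π ⟨(i : ℕ) + k, by omega⟩ ≠ π ⟨(i : ℕ) + k + 1, by omega⟩ := by
        intro h6
        have h7 := π.injective h6
        simp at h7
      have h8 := lt_of_le_of_ne h4 h5
      rw [Fin.lt_def] at h8
      have h9 : (i : ℕ) + (k + 1) = (i : ℕ) + k + 1 := by omega
      simp only [h9]
      omega
  have hlast := key (n - 1 - i) (by omega)
  have hb := (π ⟨(i : ℕ) + (n - 1 - i), by omega⟩).isLt
  rw [Fin.lt_def] at hi
  omega

/-- `exc π ≤ maj π`, so the exponent `maj π - exc π` below is never truncated. -/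
theorem exc_le_maj {n : ℕ} (π : Equiv.Perm (Fin n)) : exc π ≤ maj π := by
  rcases (Finset.univ.filter fun i : Fin n => i < π i).eq_empty_or_nonempty with h0 | hne
  · simp [exc, h0]
  · obtain ⟨i, hi, hmax⟩ := Finset.exists_max_image _ id hne
    obtain ⟨j, hj, hij⟩ := exists_descent_of_lt π i (by simpa using hi)
    have h1 : exc π ≤ (Finset.Iic i).card := by
      apply Finset.card_le_card
      intro a ha
      exact Finset.mem_Iic.mpr (hmax a ha)
    rw [Fin.card_Iic] at h1
    have h2 : (j : ℕ) + 1 ≤ maj π :=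
      Finset.single_le_sum (f := fun i : Fin n => (i : ℕ) + 1) (fun _ _ => Nat.zero_le _) hj
    rw [Fin.le_def] at hij
    omega

noncomputable section

/-! ### Eulerian polynomials

Polynomials in `t` live in `ℤ[X]`. Polynomials in `t` and `q` live in `ℤ[X][X]`, where
the outer variable is `q = X` and the inner one is `t = C X`. -/

/-- The Eulerian polynomial `A_n(t) = ∑_π t ^ des π`, with the convention `A_0(t) = 0`. -/
def eulerianPoly (n : ℕ) : ℤ[X] :=
  if n = 0 then 0 else ∑ π : Equiv.Perm (Fin n), X ^ des π

/-- The (maj, exc)-Eulerian polynomial `A_n(t, q) = ∑_π t ^ exc π * q ^ (maj π - exc π)`. -/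
def qEulerianPoly (n : ℕ) : ℤ[X][X] :=
  ∑ π : Equiv.Perm (Fin n), (C X) ^ exc π * X ^ (maj π - exc π)

/-- `(q; q)_n = ∏_{i = 1}^{n} (1 - q ^ i)`. -/
def qPoch (n : ℕ) : ℤ[X][X] := ∏ i ∈ Finset.range n, (1 - X ^ (i + 1))

/-- The `q`-binomial coefficient, as a polynomial in `q`, by the `q`-Pascal rule. It is the
quotient `(q; q)_n / ((q; q)_m (q; q)_{n - m})`, see `qBinom_mul` and `qPoch_ne_zero`. -/
def qBinom : ℕ → ℕ → ℤ[X][X]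
  | _, 0 => 1
  | 0, _ + 1 => 0
  | n + 1, m + 1 => qBinom n m + X ^ (m + 1) * qBinom n (m + 1)

theorem qPoch_succ (n : ℕ) : qPoch (n + 1) = qPoch n * (1 - X ^ (n + 1)) :=
  Finset.prod_range_succ _ _

theorem qPoch_ne_zero (n : ℕ) : qPoch n ≠ 0 := by
  refine Finset.prod_ne_zero_iff.mpr fun i _ h => ?_
  have h1 := congrArg (Polynomial.eval 0) h
  simp at h1

theorem qBinom_eq_zero (n : ℕ) : ∀ m, n < m → qBinom n m = 0 := by
  induction n with
  | zero =>
    intro m hm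
    obtain ⟨m, rfl⟩ := Nat.exists_eq_succ_of_ne_zero (by omega : m ≠ 0)
    simp [qBinom]
  | succ n ih =>
    intro m hm
    obtain ⟨m, rfl⟩ := Nat.exists_eq_succ_of_ne_zero (by omega : m ≠ 0)
    simp [qBinom, ih m (by omega), ih (m + 1) (by omega)]

theorem qBinom_self (n : ℕ) : qBinom n n = 1 := by
  induction n with
  | zero => simp [qBinom]
  | succ n ih => simp [qBinom, ih, qBinom_eq_zero n (n + 1) (by omega)]

/-- The defining quotient of the `q`-binomial coefficient, with denominators cleared. -/
theorem qBinom_mul (n : ℕ) : ∀ m ≤ n, qBinom n m * (qPoch m * qPoch (n - m)) = qPoch n := by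
  induction n with
  | zero =>
    intro m hm
    obtain rfl : m = 0 := by omega
    simp [qBinom, qPoch]
  | succ n ih =>
    intro m hm
    rcases m with _ | m
    · simp [qBinom, qPoch]
    rcases Nat.lt_or_ge m n with h | h
    · obtain ⟨l, rfl⟩ : ∃ l, n = m + l + 1 := ⟨n - m - 1, by omega⟩
      have h1 := ih m (by omega)
      have h2 := ih (m + 1) (by omega)
      rw [show m + l + 1 - m = l + 1 by omega] at h1
      rw [show m + l + 1 - (m + 1) = l by omega] at h2
      rw [show m + l + 1 + 1 - (m + 1) = l + 1 by omega, qBinom, qPoch_succ (m + l + 1)]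
      have e1 := qPoch_succ m
      have e2 := qPoch_succ l
      calc _ = (1 - X ^ (m + 1)) * (qBinom (m + l + 1) m * (qPoch m * qPoch (l + 1)))
            + X ^ (m + 1) * (1 - X ^ (l + 1)) *
              (qBinom (m + l + 1) (m + 1) * (qPoch (m + 1) * qPoch l)) := by
              rw [e1, e2]; ring
        _ = _ := by rw [h1, h2]; ring
    · obtain rfl : m = n := by omega
      rw [qBinom_self]
      simp [qPoch]

/-- The `q`-binomial-Eulerian polynomial
`Ã_n(t, q) = 1 + t * ∑_{m = 1}^{n} [n choose m]_q * A_m(t, q)`. -/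
def qBinomialEulerianPoly (n : ℕ) : ℤ[X][X] :=
  1 + C X * ∑ m ∈ Finset.Icc 1 n, qBinom n m * qEulerianPoly m

end

end QBinomialEulerian

namespace QBinomialEulerian

/-! ### The `q`-binomial coefficients at `q = -1` -/

/-! Two evaluations at `q = -1` carry the theorem. The `q`-binomials collapse to ordinary ones, with
zeros at odd entries of even rows. The `q`-Eulerian polynomials satisfy `A_n(t, -1) = (1 + t) ^
⌊n/2⌋ * A_⌈n/2⌉(t)`; splitting the sum by parity of the index then gives both formulas.

For the second evaluation, the weight is `(-t) ^ exc * (-1) ^ maj`, and only descents at odd 1-based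
positions affect the sign. So the weight is a product over the pairs of 0-based positions `2j, 2j +
1`. Averaging over the swap of the two values of a pair kills it unless one value is `2j + 1`; in
that case the pair contributes `1 + t` times the excedance weight of the other value at `2j`. What
survives are permutations fixing every odd element, i.e. permutations of the `⌈n/2⌉` even ones,
counted by excedances. MacMahon's equidistribution of `des` and `exc` turns this count into an
Eulerian polynomial. -/

theorem eval_neg_one_qBinom_succ (n m : ℕ) :
    (qBinom (n + 1) (m + 1)).eval (-1) =
      (qBinom n m).eval (-1) + (-1) ^ (m + 1) * (qBinom n (m + 1)).eval (-1) := by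
  simp [qBinom]

theorem qBinom_zero_right (n : ℕ) : qBinom n 0 = 1 := by
  cases n <;> rfl

/-- The odd rows at `q = -1` follow from the even ones. -/
theorem eval_neg_one_qBinom_odd_of_even {m : ℕ}
    (h : ∀ k, (qBinom (2 * m) (2 * k)).eval (-1) = (m.choose k : ℤ[X]) ∧
      (qBinom (2 * m) (2 * k + 1)).eval (-1) = 0) (k : ℕ) :
    (qBinom (2 * m + 1) (2 * k)).eval (-1) = (m.choose k : ℤ[X]) ∧
    (qBinom (2 * m + 1) (2 * k + 1)).eval (-1) = (m.choose k : ℤ[X]) := by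
  refine ⟨?_, ?_⟩
  · cases k with
    | zero => simp [qBinom_zero_right]
    | succ k =>
      rw [show 2 * (k + 1) = 2 * k + 1 + 1 by ring, eval_neg_one_qBinom_succ, (h k).2,
        show 2 * k + 1 + 1 = 2 * (k + 1) by ring, (h (k + 1)).1]
      simp [pow_mul]
  · rw [eval_neg_one_qBinom_succ, (h k).1, (h k).2]
    simp

/-- Two steps of the `q`-Pascal rule at `q = -1`: the signs make even entries add by the ordinary
Pascal rule and odd entries cancel. -/
theorem eval_neg_one_qBinom (m : ℕ) : ∀ k : ℕ,
    (qBinom (2 * m) (2 * k)).eval (-1) = (m.choose k : ℤ[X]) ∧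
    (qBinom (2 * m) (2 * k + 1)).eval (-1) = 0 := by
  induction m with
  | zero =>
    intro k
    cases k with
    | zero => simp [qBinom]
    | succ k => simp [qBinom_eq_zero]
  | succ m ih =>
    intro k
    have odd := eval_neg_one_qBinom_odd_of_even ih
    rw [show 2 * (m + 1) = 2 * m + 1 + 1 by ring]
    refine ⟨?_, ?_⟩
    · cases k with
      | zero => simp [qBinom_zero_right]
      | succ k =>
        rw [show 2 * (k + 1) = 2 * k + 1 + 1 by ring, eval_neg_one_qBinom_succ, (odd k).2,
          show 2 * k + 1 + 1 = 2 * (k + 1) by ring, (odd (k + 1)).1, Nat.choose_succ_succ]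
        simp [pow_mul]
    · rw [eval_neg_one_qBinom_succ, (odd k).1, (odd k).2]
      simp [pow_succ, pow_mul]

theorem eval_neg_one_qBinom_odd (m k : ℕ) :
    (qBinom (2 * m + 1) (2 * k)).eval (-1) = (m.choose k : ℤ[X]) ∧
    (qBinom (2 * m + 1) (2 * k + 1)).eval (-1) = (m.choose k : ℤ[X]) :=
  eval_neg_one_qBinom_odd_of_even (eval_neg_one_qBinom m) k

/-! ### Equidistribution of descents and excedances -/

/-- The Eulerian recurrence in counting form: an object with statistic `k` has `1 + k` extensions
that keep `k` and `n - k` that raise it by one. Both `exc` and `des` fit this pattern. -/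
theorem sum_X_pow_recurrence {ι : Type*} (s : Finset ι) (f : ι → ℕ) (n : ℕ)
    (hf : ∀ i ∈ s, f i ≤ n) :
    ∑ i ∈ s, (((1 + f i : ℕ) : ℤ[X]) * X ^ f i + ((n - f i : ℕ) : ℤ[X]) * X ^ (f i + 1)) =
      (1 + (n : ℤ[X]) * X) * ∑ i ∈ s, (X : ℤ[X]) ^ f i
        + (X - X ^ 2) * derivative (∑ i ∈ s, (X : ℤ[X]) ^ f i) := by
  rw [derivative_sum, Finset.mul_sum, Finset.mul_sum, ← Finset.sum_add_distrib]
  refine Finset.sum_congr rfl fun i hi => ?_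
  rw [Nat.cast_sub (hf i hi), derivative_X_pow]
  cases h : f i with
  | zero => simp
  | succ k => simp; ring

theorem exc_eq_sum {n : ℕ} (π : Equiv.Perm (Fin n)) :
    exc π = ∑ i : Fin n, if i < π i then 1 else 0 := by
  simp [exc]

theorem exc_le {n : ℕ} (π : Equiv.Perm (Fin n)) : exc π ≤ n :=
  (Finset.card_le_univ _).trans_eq (Fintype.card_fin n)

theorem exc_decomposeFin_zero {n : ℕ} (σ : Equiv.Perm (Fin n)) :
    exc (Equiv.Perm.decomposeFin.symm (0, σ)) = exc σ := by
  rw [exc_eq_sum, exc_eq_sum, Fin.sum_univ_succ]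
  simp

/-- The new position `0` takes over the value of `i` and becomes an excedance, while `i.succ` is
sent to `0` and cannot be one. -/
theorem exc_decomposeFin_succ {n : ℕ} (σ : Equiv.Perm (Fin n)) (i : Fin n) :
    exc (Equiv.Perm.decomposeFin.symm ((σ i).succ, σ)) =
      if i < σ i then exc σ else exc σ + 1 := by
  have h : ∀ j, j ≠ i → Equiv.swap 0 (σ i).succ (σ j).succ = (σ j).succ := fun j hj =>
    Equiv.swap_apply_of_ne_of_ne (Fin.succ_ne_zero _) (by simpa using hj)
  rw [exc_eq_sum, exc_eq_sum, Fin.sum_univ_succ, ← Finset.add_sum_erase _ _ (Finset.mem_univ i),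
    ← Finset.add_sum_erase _ _ (Finset.mem_univ i)]
  have h2 : ∑ j ∈ Finset.univ.erase i,
      (if j.succ < Equiv.Perm.decomposeFin.symm ((σ i).succ, σ) j.succ then 1 else 0) =
      ∑ j ∈ Finset.univ.erase i, if j < σ j then 1 else 0 := by
    refine Finset.sum_congr rfl fun j hj => ?_
    rw [Equiv.Perm.decomposeFin_symm_apply_succ, h j (Finset.ne_of_mem_erase hj)]
    simp
  rw [h2]
  simp
  split_ifs <;> omega

theorem sum_X_pow_exc_succ (n : ℕ) :
    ∑ π : Equiv.Perm (Fin (n + 1)), (X : ℤ[X]) ^ exc π =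
      (1 + (n : ℤ[X]) * X) * ∑ σ : Equiv.Perm (Fin n), (X : ℤ[X]) ^ exc σ
        + (X - X ^ 2) * derivative (∑ σ : Equiv.Perm (Fin n), (X : ℤ[X]) ^ exc σ) := by
  rw [← sum_X_pow_recurrence _ _ n fun σ _ => exc_le σ,
    ← Equiv.sum_comp Equiv.Perm.decomposeFin.symm, Fintype.sum_prod_type_right]
  refine Finset.sum_congr rfl fun σ _ => ?_
  -- Reindexing the image of `0` by `σ` names the position `i` that loses its value.
  rw [Fin.sum_univ_succ, ← Equiv.sum_comp σ]
  simp_rw [exc_decomposeFin_succ, exc_decomposeFin_zero]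
  have h1 : (n - exc σ : ℕ) = (Finset.univ.filter fun i : Fin n => ¬ i < σ i).card := by
    have := Finset.card_filter_add_card_filter_not (s := (Finset.univ : Finset (Fin n)))
      (fun i => i < σ i)
    rw [Finset.card_univ, Fintype.card_fin] at this
    unfold exc
    omega
  simp_rw [apply_ite (fun k => (X : ℤ[X]) ^ k)]
  rw [Finset.sum_ite, Finset.sum_const, Finset.sum_const, ← h1]
  change _ + (exc σ • _ + _) = _
  simp only [nsmul_eq_mul]
  push_cast
  ring

/-- The one-line notation of `π` as a function on `ℕ`, continued by the identity. -/
def word {n : ℕ} (π : Equiv.Perm (Fin n)) (i : ℕ) : ℕ := if h : i < n then π ⟨i, h⟩ else i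

theorem word_val {n : ℕ} (π : Equiv.Perm (Fin n)) (i : Fin n) : word π i = π i := by
  simp [word]

theorem word_of_lt {n : ℕ} (π : Equiv.Perm (Fin n)) {i : ℕ} (h : i < n) :
    word π i = π ⟨i, h⟩ := dif_pos h

theorem word_of_le {n : ℕ} (π : Equiv.Perm (Fin n)) {i : ℕ} (h : n ≤ i) : word π i = i :=
  dif_neg (by omega)

theorem word_lt {n : ℕ} (π : Equiv.Perm (Fin n)) {i : ℕ} (h : i < n) : word π i < n := by
  rw [word_of_lt π h]
  exact Fin.isLt _

theorem word_injective {n : ℕ} (π : Equiv.Perm (Fin n)) : Function.Injective (word π) := by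
  intro i j h
  rcases lt_or_ge i n with hi | hi <;> rcases lt_or_ge j n with hj | hj
  · rw [word_of_lt π hi, word_of_lt π hj] at h
    simpa using π.injective (Fin.ext h)
  · have := word_lt π hi
    rw [h, word_of_le π hj] at this
    omega
  · have := word_lt π hj
    rw [← h, word_of_le π hi] at this
    omega
  · rwa [word_of_le π hi, word_of_le π hj] at h

/-- Since `word π n = n` exceeds all values, the last position needs no boundary condition. -/
theorem mem_descents_iff {n : ℕ} (π : Equiv.Perm (Fin n)) (i : Fin n) :
    i ∈ descents π ↔ word π (i + 1) < word π i := by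
  simp only [descents, Finset.mem_filter, Finset.mem_univ, true_and]
  constructor
  · rintro ⟨h, h'⟩
    rwa [word_of_lt π h, word_val]
  · intro h
    have h1 : (i : ℕ) + 1 < n := by
      by_contra h2
      have h3 := word_lt π i.isLt
      rw [word_of_le π (by omega : n ≤ (i : ℕ) + 1)] at h
      omega
    refine ⟨h1, ?_⟩
    rwa [word_of_lt π h1, word_val] at h

theorem des_eq_sum {n : ℕ} (π : Equiv.Perm (Fin n)) :
    des π = ∑ i ∈ Finset.range n, if word π (i + 1) < word π i then 1 else 0 := by
  rw [Finset.sum_range (fun i => if word π (i + 1) < word π i then 1 else 0), des,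
    Finset.sum_boole, Nat.cast_id]
  congr 1
  ext i
  simp [mem_descents_iff]

theorem des_le {n : ℕ} (π : Equiv.Perm (Fin n)) : des π ≤ n :=
  (Finset.card_le_univ _).trans_eq (Fintype.card_fin n)

/-- Insert the smallest value at position `p`. -/
def insertZero {n : ℕ} (p : Fin (n + 1)) (σ : Equiv.Perm (Fin n)) : Equiv.Perm (Fin (n + 1)) :=
  (finSuccEquiv' p).trans ((Equiv.optionCongr σ).trans (finSuccEquiv' 0).symm)

theorem insertZero_self {n : ℕ} (p : Fin (n + 1)) (σ : Equiv.Perm (Fin n)) :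
    insertZero p σ p = 0 := by
  simp [insertZero]

theorem insertZero_succAbove {n : ℕ} (p : Fin (n + 1)) (σ : Equiv.Perm (Fin n)) (i : Fin n) :
    insertZero p σ (p.succAbove i) = (σ i).succ := by
  simp [insertZero]

theorem insertZero_bijective (n : ℕ) :
    Function.Bijective fun x : Fin (n + 1) × Equiv.Perm (Fin n) => insertZero x.1 x.2 := by
  rw [Fintype.bijective_iff_injective_and_card]
  constructor
  · rintro ⟨p, σ⟩ ⟨q, τ⟩ h
    replace h : insertZero p σ = insertZero q τ := h
    obtain rfl : p = q := (insertZero p σ).injective (by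
      rw [insertZero_self, h, insertZero_self])
    refine Prod.ext rfl (Equiv.ext fun i => ?_)
    have := insertZero_succAbove p σ i
    rw [h, insertZero_succAbove] at this
    exact (Fin.succ_injective _ this).symm
  · simp [Fintype.card_perm, Nat.factorial_succ]

theorem word_insertZero_self {n : ℕ} (p : Fin (n + 1)) (σ : Equiv.Perm (Fin n)) :
    word (insertZero p σ) p = 0 := by
  rw [word_val, insertZero_self]
  rfl

theorem word_insertZero_of_lt {n : ℕ} (p : Fin (n + 1)) (σ : Equiv.Perm (Fin n)) {i : ℕ}
    (h : i < p) : word (insertZero p σ) i = word σ i + 1 := by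
  have hp := p.isLt
  have h1 : i < n := by omega
  have := insertZero_succAbove p σ ⟨i, h1⟩
  rw [Fin.succAbove_of_castSucc_lt _ _ (by simpa [Fin.lt_def] using h)] at this
  rw [word_of_lt σ h1, word_of_lt _ (by omega : i < n + 1)]
  simpa using congrArg Fin.val this

theorem word_insertZero_of_le {n : ℕ} (p : Fin (n + 1)) (σ : Equiv.Perm (Fin n)) {i : ℕ}
    (h : p ≤ i) : word (insertZero p σ) (i + 1) = word σ i + 1 := by
  rcases lt_or_ge i n with h1 | h1
  · have := insertZero_succAbove p σ ⟨i, h1⟩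
    rw [Fin.succAbove_of_le_castSucc _ _ (by simpa [Fin.le_def] using h)] at this
    rw [word_of_lt σ h1, word_of_lt _ (by omega : i + 1 < n + 1)]
    simpa using congrArg Fin.val this
  · rw [word_of_le σ h1, word_of_le _ (by omega : n + 1 ≤ i + 1)]

theorem des_insertZero_zero {n : ℕ} (σ : Equiv.Perm (Fin n)) : des (insertZero 0 σ) = des σ := by
  rw [des_eq_sum, des_eq_sum, Finset.sum_range_succ', show word (insertZero 0 σ) 0 = 0 from
    word_insertZero_self 0 σ]
  have h (i : ℕ) : word (insertZero 0 σ) (i + 1) = word σ i + 1 :=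
    word_insertZero_of_le 0 σ (Nat.zero_le i)
  simp [h]

/-- Putting the minimum just after `k` forces a descent at `k` followed by an ascent, replacing
whatever stood between `k` and `k + 1`. -/
theorem des_insertZero_succ {n : ℕ} (σ : Equiv.Perm (Fin n)) (k : Fin n) :
    des (insertZero k.succ σ) = if k ∈ descents σ then des σ else des σ + 1 := by
  obtain ⟨r, hr⟩ : ∃ r, n = k + (1 + r) := ⟨n - k - 1, by omega⟩
  have h0 := word_insertZero_self k.succ σ
  have h1 : ∀ i < (k : ℕ) + 1, word (insertZero k.succ σ) i = word σ i + 1 := fun i hi =>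
    word_insertZero_of_lt k.succ σ (by simpa using hi)
  have h2 : ∀ i, (k : ℕ) + 1 ≤ i → word (insertZero k.succ σ) (i + 1) = word σ i + 1 := fun i hi =>
    word_insertZero_of_le k.succ σ (by simpa using hi)
  rw [Fin.val_succ] at h0
  simp only [des_eq_sum, mem_descents_iff]
  generalize word (insertZero k.succ σ) = v at *
  generalize word σ = w at *
  generalize (k : ℕ) = l at *
  subst hr
  rw [show l + (1 + r) + 1 = l + (1 + (1 + r)) by ring, Finset.sum_range_add,
    Finset.sum_range_add _ 1, Finset.sum_range_add _ 1, Finset.sum_range_add _ l,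
    Finset.sum_range_add _ 1]
  have e1 : ∑ i ∈ Finset.range l, (if v (i + 1) < v i then 1 else 0) =
      ∑ i ∈ Finset.range l, if w (i + 1) < w i then 1 else 0 := by
    refine Finset.sum_congr rfl fun i hi => ?_
    have := Finset.mem_range.mp hi
    rw [h1 i (by omega), h1 (i + 1) (by omega)]
    simp
  have e2 : ∑ i ∈ Finset.range r,
      (if v (l + (1 + (1 + i)) + 1) < v (l + (1 + (1 + i))) then 1 else 0) =
      ∑ i ∈ Finset.range r, if w (l + (1 + i) + 1) < w (l + (1 + i)) then 1 else 0 := by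
    refine Finset.sum_congr rfl fun i _ => ?_
    rw [h2 _ (by omega), show l + (1 + (1 + i)) = l + (1 + i) + 1 by ring, h2 _ (by omega)]
    simp
  rw [e1, e2]
  simp only [Finset.sum_range_one, add_zero, h0, h1 l (by omega), Nat.not_lt_zero, if_false,
    Nat.zero_lt_succ, if_true]
  split_ifs <;> omega

theorem sum_X_pow_des_succ (n : ℕ) :
    ∑ π : Equiv.Perm (Fin (n + 1)), (X : ℤ[X]) ^ des π =
      (1 + (n : ℤ[X]) * X) * ∑ σ : Equiv.Perm (Fin n), (X : ℤ[X]) ^ des σ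
        + (X - X ^ 2) * derivative (∑ σ : Equiv.Perm (Fin n), (X : ℤ[X]) ^ des σ) := by
  rw [← sum_X_pow_recurrence _ _ n fun σ _ => des_le σ,
    ← (insertZero_bijective n).sum_comp, Fintype.sum_prod_type_right]
  refine Finset.sum_congr rfl fun σ _ => ?_
  rw [Fin.sum_univ_succ]
  simp_rw [des_insertZero_succ, des_insertZero_zero]
  have h1 : (n - des σ : ℕ) = (Finset.univ.filter fun i : Fin n => ¬ i ∈ descents σ).card := by
    have := Finset.card_filter_add_card_filter_not (s := (Finset.univ : Finset (Fin n)))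
      (fun i => i ∈ descents σ)
    rw [Finset.card_univ, Fintype.card_fin, Finset.filter_univ_mem] at this
    unfold des
    omega
  simp_rw [apply_ite (fun k => (X : ℤ[X]) ^ k)]
  rw [Finset.sum_ite, Finset.sum_const, Finset.sum_const, ← h1, Finset.filter_univ_mem]
  change _ + (des σ • _ + _) = _
  simp only [nsmul_eq_mul]
  push_cast
  ring

theorem sum_X_pow_des_eq_sum_X_pow_exc (n : ℕ) :
    ∑ π : Equiv.Perm (Fin n), (X : ℤ[X]) ^ des π = ∑ π : Equiv.Perm (Fin n), X ^ exc π := by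
  induction n with
  | zero => simp [des, exc, descents]
  | succ n ih => rw [sum_X_pow_des_succ, sum_X_pow_exc_succ, ih]

/-! ### Symmetrization over pairs of positions -/

theorem word_mul_swap {n : ℕ} (π : Equiv.Perm (Fin n)) (a b : Fin n) (i : ℕ) :
    word (π * Equiv.swap a b) i = word π (Equiv.swap (a : ℕ) b i) := by
  rcases lt_or_ge i n with h | h
  · rw [word_of_lt _ h, Equiv.Perm.mul_apply, ← word_val]
    congr 1
    rw [Equiv.swap_apply_def, Equiv.swap_apply_def]
    simp only [Fin.ext_iff]
    split_ifs <;> rfl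
  · rw [word_of_le _ h, Equiv.swap_apply_of_ne_of_ne (by omega) (by omega), word_of_le _ h]

theorem two_mul_sum_eq_sum_add_mul_swap {R : Type*} [CommRing R] {n : ℕ} (a b : Fin n)
    (F : Equiv.Perm (Fin n) → R) :
    2 * ∑ π, F π = ∑ π, (F π + F (π * Equiv.swap a b)) := by
  rw [Finset.sum_add_distrib, two_mul]
  exact congrArg _ (Equiv.sum_comp (Equiv.mulRight (Equiv.swap a b)) F).symm

/-- Two products over the pairs of positions `2 * j, 2 * j + 1` have the same sum over all
permutations if their factors have the same symmetrizations. -/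
theorem sum_prod_pairs_congr {n : ℕ} (f h : ℕ → ℕ → ℕ → ℤ[X])
    (hfh : ∀ j a b, a ≠ b → f j a b + f j b a = h j a b + h j b a) :
    ∑ π : Equiv.Perm (Fin n), ∏ j ∈ Finset.range (n / 2), f j (word π (2 * j)) (word π (2 * j + 1))
      = ∑ π : Equiv.Perm (Fin n),
          ∏ j ∈ Finset.range (n / 2), h j (word π (2 * j)) (word π (2 * j + 1)) := by
  -- The factors are exchanged one pair at a time; `R` below collects the other pairs, which the
  -- swap leaves alone.
  have key : ∀ k ≤ n / 2, ∑ π : Equiv.Perm (Fin n),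
      ∏ j ∈ Finset.range (n / 2), f j (word π (2 * j)) (word π (2 * j + 1)) =
      ∑ π : Equiv.Perm (Fin n), ∏ j ∈ Finset.range (n / 2),
        (if j < k then h else f) j (word π (2 * j)) (word π (2 * j + 1)) := by
    intro k
    induction k with
    | zero => simp
    | succ k ih =>
      intro hk
      rw [ih (by omega)]
      set R : Equiv.Perm (Fin n) → ℤ[X] := fun π => ∏ j ∈ (Finset.range (n / 2)).erase k,
        (if j < k then h else f) j (word π (2 * j)) (word π (2 * j + 1)) with hR
      let a : Fin n := ⟨2 * k, by omega⟩
      let b : Fin n := ⟨2 * k + 1, by omega⟩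
      have hk' : k ∈ Finset.range (n / 2) := Finset.mem_range.mpr (by omega)
      have hRs : ∀ π, R (π * Equiv.swap a b) = R π := by
        intro π
        refine Finset.prod_congr rfl fun j hj => ?_
        have hjk := Finset.ne_of_mem_erase hj
        rw [word_mul_swap, word_mul_swap,
          Equiv.swap_apply_of_ne_of_ne (by simp [a]; omega) (by simp [b]; omega),
          Equiv.swap_apply_of_ne_of_ne (by simp [a]; omega) (by simp [b]; omega)]
      have e1 : ∀ π : Equiv.Perm (Fin n), ∏ j ∈ Finset.range (n / 2),
          (if j < k then h else f) j (word π (2 * j)) (word π (2 * j + 1)) =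
          f k (word π (2 * k)) (word π (2 * k + 1)) * R π := by
        intro π
        rw [← Finset.mul_prod_erase _ _ hk', if_neg (lt_irrefl k)]
      have e2 : ∀ π : Equiv.Perm (Fin n), ∏ j ∈ Finset.range (n / 2),
          (if j < k + 1 then h else f) j (word π (2 * j)) (word π (2 * j + 1)) =
          h k (word π (2 * k)) (word π (2 * k + 1)) * R π := by
        intro π
        rw [← Finset.mul_prod_erase _ _ hk', if_pos (Nat.lt_succ_self k)]
        congr 1
        refine Finset.prod_congr rfl fun j hj => ?_
        have hjk := Finset.ne_of_mem_erase hj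
        simp only [show j < k + 1 ↔ j < k by omega]
      simp_rw [e1, e2]
      refine mul_left_cancel₀ (two_ne_zero : (2 : ℤ[X]) ≠ 0) ?_
      rw [two_mul_sum_eq_sum_add_mul_swap a b, two_mul_sum_eq_sum_add_mul_swap a b]
      refine Finset.sum_congr rfl fun π _ => ?_
      have sa : Equiv.swap (a : ℕ) b (2 * k) = 2 * k + 1 := Equiv.swap_apply_left _ _
      have sb : Equiv.swap (a : ℕ) b (2 * k + 1) = 2 * k := Equiv.swap_apply_right _ _
      rw [hRs, word_mul_swap, word_mul_swap, sa, sb, ← add_mul, ← add_mul,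
        hfh k _ _ fun hw => by simpa using word_injective π hw]
  rw [key _ le_rfl]
  refine Finset.sum_congr rfl fun π _ => Finset.prod_congr rfl fun j hj => ?_
  rw [if_pos (Finset.mem_range.mp hj)]

theorem prod_range_two_mul {M : Type*} [CommMonoid M] (F : ℕ → M) (m : ℕ) :
    ∏ i ∈ Finset.range (2 * m), F i = ∏ j ∈ Finset.range m, (F (2 * j) * F (2 * j + 1)) := by
  induction m with
  | zero => simp
  | succ m ih =>
    rw [show 2 * (m + 1) = 2 * m + 1 + 1 by ring, Finset.prod_range_succ, Finset.prod_range_succ,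
      ih, Finset.prod_range_succ, mul_assoc]

theorem word_last_le {n : ℕ} (π : Equiv.Perm (Fin (n + 1))) : word π n ≤ n :=
  Nat.le_of_lt_succ (word_lt π (Nat.lt_succ_self n))

theorem exc_eq_sum_word {n : ℕ} (π : Equiv.Perm (Fin n)) :
    exc π = ∑ i ∈ Finset.range n, if i < word π i then 1 else 0 := by
  rw [Finset.sum_range (fun i => if i < word π i then 1 else 0), exc_eq_sum]
  simp [word_val]

theorem maj_eq_sum_word {n : ℕ} (π : Equiv.Perm (Fin n)) :
    maj π = ∑ i ∈ Finset.range n, if word π (i + 1) < word π i then i + 1 else 0 := by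
  rw [Finset.sum_range (fun i => if word π (i + 1) < word π i then i + 1 else 0), maj,
    ← Finset.sum_filter]
  refine Finset.sum_congr ?_ fun _ _ => rfl
  ext i
  simp [mem_descents_iff]

/-- A descent at 0-based position `i` has sign `(-1) ^ (i + 1)`, so only even `i` matter, and these
compare the two entries of one pair. -/
theorem X_pow_exc_mul_neg_one_pow {n : ℕ} (π : Equiv.Perm (Fin n)) :
    (X : ℤ[X]) ^ exc π * (-1) ^ (maj π - exc π) = ∏ j ∈ Finset.range (n / 2),
      ((if 2 * j < word π (2 * j) then -X else 1) *
        (if 2 * j + 1 < word π (2 * j + 1) then -X else 1) *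
        if word π (2 * j + 1) < word π (2 * j) then -1 else 1) := by
  have h1 : (X : ℤ[X]) ^ exc π * (-1) ^ (maj π - exc π) = (-X) ^ exc π * (-1) ^ maj π := by
    conv_rhs => rw [← Nat.sub_add_cancel (exc_le_maj π), neg_pow, pow_add]
    have : ((-1 : ℤ[X]) ^ exc π) * (-1) ^ exc π = 1 := by
      rw [← mul_pow]; simp
    linear_combination (-(X ^ exc π * (-1) ^ (maj π - exc π))) * this
  let F : ℕ → ℤ[X] := fun i => (if i < word π i then -X else 1) *
    if word π (i + 1) < word π i then (-1) ^ (i + 1) else 1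
  have h2 : (-X : ℤ[X]) ^ exc π * (-1) ^ maj π = ∏ i ∈ Finset.range n, F i := by
    rw [exc_eq_sum_word, maj_eq_sum_word, ← Finset.prod_pow_eq_pow_sum,
      ← Finset.prod_pow_eq_pow_sum, ← Finset.prod_mul_distrib]
    refine Finset.prod_congr rfl fun i _ => ?_
    simp only [F]
    split_ifs <;> simp
  -- For odd `n` the unpaired last position is neither an excedance nor a descent.
  have h3 : ∏ i ∈ Finset.range n, F i = ∏ i ∈ Finset.range (2 * (n / 2)), F i := by
    rcases Nat.even_or_odd' n with ⟨m, rfl | rfl⟩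
    · rw [show 2 * m / 2 = m by omega]
    · rw [show (2 * m + 1) / 2 = m by omega, Finset.prod_range_succ]
      have := word_last_le π
      have h4 : word π (2 * m + 1) = 2 * m + 1 := word_of_le π le_rfl
      simp only [F]
      rw [if_neg (by omega), if_neg (by omega), mul_one, mul_one]
  rw [h1, h2, h3, prod_range_two_mul]
  refine Finset.prod_congr rfl fun j _ => ?_
  have e1 : (-1 : ℤ[X]) ^ (2 * j + 1) = -1 := by simp [pow_succ, pow_mul]
  have e2 : (-1 : ℤ[X]) ^ (2 * j + 1 + 1) = 1 := by simp [pow_succ, pow_mul]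
  simp only [F, e1, e2, ite_self, mul_one]
  ring

/-! ### Permutations fixing the odd elements, and `A_n(t, -1)` -/

theorem even_lt_div {n : ℕ} (i : Fin ((n + 1) / 2)) : 2 * (i : ℕ) < n := by
  omega

/-- The even elements of `Fin n`, enumerated increasingly. -/
def evenEquiv (n : ℕ) : Fin ((n + 1) / 2) ≃ {a : Fin n // Even (a : ℕ)} where
  toFun i := ⟨⟨2 * i, even_lt_div i⟩, even_two_mul _⟩
  invFun a := ⟨a / 2, by have := a.1.isLt; have := a.2; grind⟩
  left_inv i := by simp
  right_inv a := by
    obtain ⟨a, ha⟩ := a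
    simpa [Subtype.ext_iff, Fin.ext_iff] using Nat.two_mul_div_two_of_even ha

/-- Permutations of `Fin n` that fix all odd elements, as permutations of the even ones. -/
def permEvenEquiv (n : ℕ) : Equiv.Perm (Fin ((n + 1) / 2)) ≃
    {π : Equiv.Perm (Fin n) // ∀ a : Fin n, ¬ Even (a : ℕ) → π a = a} :=
  (evenEquiv n).permCongr.trans
    (Equiv.Perm.subtypeEquivSubtypePerm fun a : Fin n => Even (a : ℕ))

theorem word_permEvenEquiv {n : ℕ} (τ : Equiv.Perm (Fin ((n + 1) / 2))) {j : ℕ}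
    (hj : j < (n + 1) / 2) : word (permEvenEquiv n τ).1 (2 * j) = 2 * word τ j := by
  have h : 2 * j < n := by omega
  rw [word_of_lt _ h, word_of_lt _ hj]
  have h1 := Equiv.Perm.ofSubtype_apply_of_mem (p := fun a : Fin n => Even (a : ℕ))
    ((evenEquiv n).permCongr τ) (a := ⟨2 * j, h⟩) (even_two_mul j)
  have h2 : (evenEquiv n).symm ⟨⟨2 * j, h⟩, even_two_mul j⟩ = ⟨j, hj⟩ := by
    simp [evenEquiv]
  simp only [permEvenEquiv, Equiv.trans_apply, Equiv.Perm.subtypeEquivSubtypePerm_apply_coe]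
  rw [h1, Equiv.permCongr_apply, h2]
  rfl

theorem forall_word_odd_iff {n : ℕ} (π : Equiv.Perm (Fin n)) :
    (∀ j ∈ Finset.range (n / 2), word π (2 * j + 1) = 2 * j + 1) ↔
      ∀ a : Fin n, ¬ Even (a : ℕ) → π a = a := by
  constructor
  · intro h a ha
    obtain ⟨j, hj⟩ := Nat.not_even_iff_odd.mp ha
    have := h j (Finset.mem_range.mpr (by omega))
    rw [← hj, word_val] at this
    exact Fin.ext this
  · intro h j hj
    have hj' : 2 * j + 1 < n := by have := Finset.mem_range.mp hj; omega
    rw [word_of_lt π hj', h ⟨2 * j + 1, hj'⟩ (by simp)]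

theorem exc_eq_sum_word_div {n : ℕ} (τ : Equiv.Perm (Fin ((n + 1) / 2))) :
    exc τ = ∑ j ∈ Finset.range (n / 2), if j < word τ j then 1 else 0 := by
  rw [exc_eq_sum_word]
  rcases Nat.even_or_odd' n with ⟨m, rfl | rfl⟩
  · exact Finset.sum_congr (congrArg _ (by omega)) fun _ _ => rfl
  · obtain ⟨l, hl⟩ : ∃ l, (2 * m + 1 + 1) / 2 = l + 1 := ⟨m, by omega⟩
    revert τ
    rw [hl, show (2 * m + 1) / 2 = l by omega]
    intro τ
    rw [Finset.sum_range_succ, if_neg (not_lt.mpr (word_last_le τ)), add_zero]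

/-- At `q = -1` the `q`-Eulerian polynomial is a multiple of an Eulerian polynomial. -/
theorem eval_neg_one_qEulerianPoly (n : ℕ) :
    (qEulerianPoly n).eval (-1) =
      (1 + X) ^ (n / 2) * ∑ τ : Equiv.Perm (Fin ((n + 1) / 2)), X ^ exc τ := by
  have h0 : (qEulerianPoly n).eval (-1) =
      ∑ π : Equiv.Perm (Fin n), (X : ℤ[X]) ^ exc π * (-1) ^ (maj π - exc π) := by
    simp [qEulerianPoly, eval_finsetSum]
  rw [h0]
  simp_rw [X_pow_exc_mul_neg_one_pow]
  rw [sum_prod_pairs_congr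
    (fun j a b => (if 2 * j < a then -X else 1) * (if 2 * j + 1 < b then -X else 1) *
      if b < a then -1 else 1)
    -- All of the symmetrized weight is placed on the order with `2 * j + 1` fixed.
    (fun j a b => if b = 2 * j + 1 then (1 + X) * X ^ (if 2 * j < a then 1 else 0) else 0) ?_]
  · simp_rw [Finset.prod_ite_zero, Finset.prod_mul_distrib, Finset.prod_const, Finset.card_range,
      forall_word_odd_iff, Finset.prod_pow_eq_pow_sum]
    rw [← Finset.sum_filter, ← Finset.mul_sum]
    congr 1
    rw [Finset.sum_subtype (p := fun π : Equiv.Perm (Fin n) =>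
      ∀ a : Fin n, ¬ Even (a : ℕ) → π a = a) _ (by simp), ← (permEvenEquiv n).sum_comp]
    refine Finset.sum_congr rfl fun τ _ => ?_
    rw [exc_eq_sum_word_div]
    congr 1
    refine Finset.sum_congr rfl fun j hj => ?_
    have := Finset.mem_range.mp hj
    rw [word_permEvenEquiv τ (by omega)]
    simp
  · intro j a b hab
    by_cases ha : a = 2 * j + 1
    · subst ha
      rcases lt_or_gt_of_ne hab with h | h
      · simp [h, hab.symm, h.not_gt, show 2 * j < b by omega]
        ring
      · simp [h, hab.symm, h.not_gt, show ¬ 2 * j < b by omega]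
        ring
    · by_cases hb : b = 2 * j + 1
      · subst hb
        rcases lt_or_gt_of_ne hab with h | h
        · simp [h, ha, h.not_gt, show ¬ 2 * j < a by omega]
        · simp [h, ha, h.not_gt, show 2 * j < a by omega]
          ring
      -- With `2 * j + 1` absent, the excedance weight is symmetric in `a, b` and the descent sign
      -- antisymmetric.
      · rw [if_neg ha, if_neg hb]
        simp only [show 2 * j < a ↔ 2 * j + 1 < a by omega, show 2 * j < b ↔ 2 * j + 1 < b by omega]
        rcases lt_or_gt_of_ne hab with h | h
        · rw [if_neg h.not_gt, if_pos h]; ring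
        · rw [if_pos h, if_neg h.not_gt]; ring

/-! ### Splitting by parity and assembly -/

theorem sum_Icc_one_two_mul {M : Type*} [AddCommMonoid M] (F : ℕ → M) (m : ℕ) :
    ∑ i ∈ Finset.Icc 1 (2 * m), F i =
      ∑ k ∈ Finset.Icc 1 m, F (2 * k) + ∑ k ∈ Finset.range m, F (2 * k + 1) := by
  induction m with
  | zero => simp
  | succ m ih =>
    rw [show 2 * (m + 1) = 2 * m + 1 + 1 by ring, Finset.sum_Icc_succ_top (by omega),
      Finset.sum_Icc_succ_top (by omega), ih, Finset.sum_Icc_succ_top (by omega),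
      Finset.sum_range_succ, show 2 * (m + 1) = 2 * m + 1 + 1 by ring]
    abel

theorem eulerianPoly_eq_sum_exc {n : ℕ} (hn : n ≠ 0) :
    eulerianPoly n = ∑ π : Equiv.Perm (Fin n), X ^ exc π := by
  rw [eulerianPoly, if_neg hn, sum_X_pow_des_eq_sum_X_pow_exc]

theorem eval_neg_one_qEulerianPoly_even {k : ℕ} (hk : k ≠ 0) :
    (qEulerianPoly (2 * k)).eval (-1) = (1 + X) ^ k * eulerianPoly k := by
  rw [eval_neg_one_qEulerianPoly, eulerianPoly_eq_sum_exc hk, show 2 * k / 2 = k by omega,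
    show (2 * k + 1) / 2 = k by omega]

theorem eval_neg_one_qEulerianPoly_odd (k : ℕ) :
    (qEulerianPoly (2 * k + 1)).eval (-1) = (1 + X) ^ k * eulerianPoly (k + 1) := by
  rw [eval_neg_one_qEulerianPoly, eulerianPoly_eq_sum_exc k.succ_ne_zero,
    show (2 * k + 1 + 1) / 2 = k + 1 by omega, show (2 * k + 1) / 2 = k by omega]

theorem eval_neg_one_qBinomialEulerianPoly (n : ℕ) :
    (qBinomialEulerianPoly n).eval (-1) = 1 + X * ∑ i ∈ Finset.Icc 1 n,
      (qBinom n i).eval (-1) * (qEulerianPoly i).eval (-1) := by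
  simp [qBinomialEulerianPoly, eval_finsetSum]

end QBinomialEulerian

open QBinomialEulerian

theorem corollary2p3 :
    (∀ m : ℕ, 1 ≤ m →
      (QBinomialEulerian.qBinomialEulerianPoly (2 * m)).eval (-1) =
        1 + Polynomial.X * ∑ k ∈ Finset.Icc 1 m,
          (m.choose k : Polynomial ℤ) * (1 + Polynomial.X) ^ k *
            QBinomialEulerian.eulerianPoly k) ∧
    (∀ m : ℕ,
      (QBinomialEulerian.qBinomialEulerianPoly (2 * m + 1)).eval (-1) =
        1 + Polynomial.X * ∑ k ∈ Finset.range (m + 1),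
          (m.choose k : Polynomial ℤ) * (1 + Polynomial.X) ^ k *
            (QBinomialEulerian.eulerianPoly k + QBinomialEulerian.eulerianPoly (k + 1))) := by
  refine ⟨fun m _ => ?_, fun m => ?_⟩
  · rw [eval_neg_one_qBinomialEulerianPoly, sum_Icc_one_two_mul]
    simp_rw [(eval_neg_one_qBinom m _).2, (eval_neg_one_qBinom m _).1]
    simp only [zero_mul, Finset.sum_const_zero, add_zero]
    congr 2
    refine Finset.sum_congr rfl fun k hk => ?_
    rw [eval_neg_one_qEulerianPoly_even (by have := Finset.mem_Icc.mp hk; omega), mul_assoc]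
  -- The top index `2 * m + 1` is split off and rejoins the odd indices, extending their range to `m
  -- + 1`.
  · rw [eval_neg_one_qBinomialEulerianPoly, Finset.sum_Icc_succ_top (by omega),
      sum_Icc_one_two_mul, add_assoc, ← Finset.sum_range_succ]
    simp_rw [(eval_neg_one_qBinom_odd m _).2, (eval_neg_one_qBinom_odd m _).1,
      eval_neg_one_qEulerianPoly_odd, mul_assoc, mul_add _ (eulerianPoly _), mul_add (Nat.cast _),
      Finset.sum_add_distrib]
    congr 3
    -- The even indices start at `2`; the extra term `k = 0` vanishes by the convention `A_0 = 0`.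
    rw [Finset.range_eq_Ico, Finset.sum_eq_sum_Ico_succ_bot (by omega)]
    rw [show eulerianPoly 0 = 0 from if_pos rfl, mul_zero, mul_zero, zero_add]
    refine Finset.sum_congr rfl fun k hk => ?_
    rw [eval_neg_one_qEulerianPoly_even (by have := Finset.mem_Icc.mp hk; omega)]
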